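/- A partially ordered abelian group is an abelian group $D$ with a partial order $\le$ such that $x \le y$ implies $x + z \le y + z$. An order unit in it is an element $u > 0$ such that for every $x \in D$ there is a positive integer $n$ with $x \le nu$. A dimension group $(D, \le, u)$ is a countable partially ordered abelian group $(D, \le)$ with an order unit $u$ such that every finite subset of $D$ is contained in a subgroup which, with the induced order, is isomorphic as a partially ordered abelian group to $\mathbb{Z}^n$ with the coordinatewise order for some integer $n \ge 0$. Theorem. Let $H \le \mathbb{Q}_+^\times$ be a subgroup of the multiplicative group of the positive rational numbers. Then there are a dimension group $(D, \le, u)$ and a group isomorphism $h \mapsto \varphi_h$ from $H$ onto the group $\operatorname{Aut}(D, \le)$ of all order-preserving automorphisms of $D$ (the group automorphisms $f$ of $D$ such that $x \le y \iff f(x) \le f(y)$; they need not fix $u$), such that every $h \in H$ acts on $u$ as multiplication by the rational number $h$: $\varphi_h(u) = hu$, i.e. $b\,\varphi_h(u) = a\,u$ where $h = a/b$ with $a, b$ coprime positive integers. (Dimension groups are torsion-free, so this equation determines $\varphi_h(u)$.) -/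

import Mathlib

/-- An order unit of a partially ordered abelian group: a positive element `u` such that every
element lies below some positive integer multiple of `u`. -/
def IsOrderUnit {D : Type*} [AddCommGroup D] [PartialOrder D] (u : D) : Prop :=
  0 < u ∧ ∀ x : D, ∃ n : ℕ, 0 < n ∧ x ≤ n • u

/-- `(D, ≤, u)` is a dimension group: `D` is a countable partially ordered abelian group with order
unit `u` such that every finite subset of `D` is contained in a subgroup which, with the order
induced from `D`, is isomorphic as a partially ordered group to some `ℤⁿ` with the product
(coordinatewise) order. -/
structure IsDimensionGroup (D : Type*) [AddCommGroup D] [PartialOrder D] [IsOrderedAddMonoid D]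
    (u : D) : Prop where
  countable : Countable D
  isOrderUnit : IsOrderUnit u
  exists_subgroup : ∀ s : Finset D, ∃ S : AddSubgroup D, (s : Set D) ⊆ (S : Set D) ∧
    ∃ n : ℕ, Nonempty (S ≃+o (Fin n → ℤ))

/-- The group `Aut (D, ≤)` of order-preserving automorphisms of a partially ordered abelian group,
under composition: the additive maps among the order automorphisms of `D`. The order unit need not
be preserved. As usual for an automorphism of an ordered structure, both the map and its inverse
preserve the order. -/
def orderAut (D : Type*) [AddCommGroup D] [PartialOrder D] : Subgroup (D ≃o D) where
  carrier := {f | ∀ x y : D, f (x + y) = f x + f y}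
  mul_mem' {f g} hf hg x y := by
    rw [RelIso.mul_apply, RelIso.mul_apply, RelIso.mul_apply, hg x y, hf (g x) (g y)]
  one_mem' _ _ := rfl
  inv_mem' {f} hf x y := by
    apply f.injective
    rw [hf, RelIso.apply_inv_self, RelIso.apply_inv_self, RelIso.apply_inv_self]

/-- `IsRatMul q x y` says that `y` is the rational multiple `q x`: writing `q = a / b` in lowest
terms, `b y = a x`. In a torsion-free group (such as a dimension group) there is at most one such
`y`. -/
def IsRatMul {D : Type*} [AddCommGroup D] (q : ℚ) (x y : D) : Prop :=
  q.den • y = q.num • x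

/-!
For the trivial subgroup, `D = ℤ` has no automorphisms. For a nontrivial, hence infinite, `H`, the
dimension group is a group of functions on a metric star: one arm, an interval `[0, h]`, for every
`h ∈ H`, all glued at their left ends, the centre of the star. It consists of the piecewise linear
functions with integer slopes, rational breakpoints and rational value at the centre that are
constant on all but finitely many arms, with the pointwise order; the order unit is the constant
function `1`. A similarity of ratio `r` of the star, followed by multiplication by `r`, preserves
integrality of slopes and sends `1` to `r`, and the similarities of the star have as ratios exactly
the elements of `H`, because they must permute the arms.

* Simplicial subgroups (`exists_simplicial_subgroup_starGroup`): finitely many functions have their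
  breakpoints in a common mesh `1 / N` on finitely many arms, and their values there are multiples
  of `1 / N`. The hat functions of height `1 / N` at the mesh points then span a simplicial
  subgroup.
* Constants (`exists_map_constHom`): slopes are integers and the star is connected, so the divisible
  elements are the constants. An automorphism therefore multiplies constants by a rational `r > 0`.
* Points (`exists_point`): the absolute values used are suprema in the group, so an automorphism
  followed by evaluation at a point is a lattice homomorphism on enough elements to be `r` times the
  evaluation at another point. This defines a bijection of the star. It fixes the centre, since a
  function in the group is constant on almost all arms (`map_armCoord_zero`).
* Similarity (`exists_arm_similarity`): the coordinate of an arm, transported by the automorphism,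
  is on each arm piecewise linear with integer slopes, nonnegative, injective where positive, and
  has open zero set off the centre. If it is not zero, its slopes are therefore positive integers
  (`sign_slope_eq`), so distances are expanded. Applied to an automorphism and to its inverse this
  shows that the bijection maps each arm onto an arm by a similarity of ratio `1 / r`, so that `r`
  is a quotient of lengths of arms and lies in `H`, and the automorphism is the one given by `r`.
-/

/-! ### The star and its piecewise linear functions -/

/-- The length of the arm of the star indexed by `h`: the rational number `h` itself. -/
def len {H : Subgroup {q : ℚ // 0 < q}} (h : H) : ℚ := ((h : {q : ℚ // 0 < q}) : ℚ)

theorem len_pos {H : Subgroup {q : ℚ // 0 < q}} (h : H) : 0 < len h :=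
  (h : {q : ℚ // 0 < q}).2

theorem len_mul {H : Subgroup {q : ℚ // 0 < q}} (g h : H) : len (g * h) = len g * len h := rfl

theorem len_one {H : Subgroup {q : ℚ // 0 < q}} : len (1 : H) = 1 := rfl

theorem len_inv {H : Subgroup {q : ℚ // 0 < q}} (h : H) : len h⁻¹ = (len h)⁻¹ := rfl

theorem len_injective {H : Subgroup {q : ℚ // 0 < q}} :
    Function.Injective (len : H → ℚ) :=
  fun _ _ h => Subtype.ext (Subtype.ext h)

/-- The function on the star that vanishes on every arm except `h`, and on the arm `h` vanishes up
to distance `c` from the centre and grows with slope one from there on. The arm `h` is the interval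
`[0, len h]`; functions on it are extended to `ℚ` by clamping the argument. -/
def ramp {H : Subgroup {q : ℚ // 0 < q}} (h : H) (c : ℚ) : H → ℚ → ℚ :=
  fun g t => if g = h then max 0 (min t (len h) - c) else 0

/-- The constant function on the star. -/
def starConst (H : Subgroup {q : ℚ // 0 < q}) (a : ℚ) : H → ℚ → ℚ := fun _ _ => a

/-- The group of functions on the star with rational value at the centre that are piecewise linear
with integer slopes and rational breakpoints, and constant on all but finitely many arms. It is
encoded by generators: a piecewise linear function is determined by its value at the centre and the
jumps of its slope. -/
def starGroup (H : Subgroup {q : ℚ // 0 < q}) : AddSubgroup (H → ℚ → ℚ) :=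
  AddSubgroup.closure (Set.range (starConst H) ∪ {f | ∃ (h : H) (c : ℚ), 0 ≤ c ∧ f = ramp h c})

section Star

variable {H : Subgroup {q : ℚ // 0 < q}}

theorem ramp_self (h : H) (c t : ℚ) : ramp h c h t = max 0 (min t (len h) - c) := by
  simp [ramp]

theorem ramp_of_ne {g h : H} (hg : g ≠ h) (c t : ℚ) : ramp h c g t = 0 := by
  simp [ramp, hg]

theorem ramp_nonneg (h : H) (c : ℚ) (g : H) (t : ℚ) : 0 ≤ ramp h c g t := by
  unfold ramp; split_ifs <;> simp

theorem ramp_zero_self {h : H} {t : ℚ} (h0 : 0 ≤ t) (ht : t ≤ len h) : ramp h 0 h t = t := by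
  rw [ramp_self, min_eq_left ht, sub_zero, max_eq_right h0]

theorem starConst_mem (a : ℚ) : starConst H a ∈ starGroup H :=
  AddSubgroup.subset_closure (Or.inl ⟨a, rfl⟩)

theorem ramp_mem (h : H) {c : ℚ} (hc : 0 ≤ c) : ramp h c ∈ starGroup H :=
  AddSubgroup.subset_closure (Or.inr ⟨h, c, hc, rfl⟩)

/-- Induction over the generators of the group of piecewise linear functions on the star. -/
theorem starGroup_induction {p : (H → ℚ → ℚ) → Prop} (hconst : ∀ a, p (starConst H a))
    (hramp : ∀ (h : H) (c : ℚ), 0 ≤ c → p (ramp h c)) (hadd : ∀ f g, p f → p g → p (f + g))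
    (hneg : ∀ f, p f → p (-f)) {f : H → ℚ → ℚ} (hf : f ∈ starGroup H) : p f := by
  induction hf using AddSubgroup.closure_induction with
  | mem f hf =>
    rcases hf with ⟨a, rfl⟩ | ⟨h, c, hc, rfl⟩
    · exact hconst a
    · exact hramp h c hc
  | zero => exact hconst 0
  | add f g _ _ hf hg => exact hadd f g hf hg
  | neg f _ hf => exact hneg f hf

instance countable_starGroup : Countable (starGroup H) := by
  have hc : (Set.range (starConst H) ∪
      {f | ∃ (h : H) (c : ℚ), 0 ≤ c ∧ f = ramp h c} : Set (H → ℚ → ℚ)).Countable := by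
    refine (Set.countable_range _).union
      ((Set.countable_range fun x : H × ℚ => ramp x.1 x.2).mono ?_)
    rintro f ⟨h, c, -, rfl⟩
    exact ⟨(h, c), rfl⟩
  have := hc.to_subtype
  have hle : (starGroup H : Set (H → ℚ → ℚ)) ⊆
      Set.range (Finsupp.linearCombination ℤ (Subtype.val : (Set.range (starConst H) ∪
        {f | ∃ (h : H) (c : ℚ), 0 ≤ c ∧ f = ramp h c} : Set (H → ℚ → ℚ)) → H → ℚ → ℚ)) := by
    rw [← LinearMap.coe_range, Finsupp.range_linearCombination, Subtype.range_coe]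
    exact (AddSubgroup.closure_le (Submodule.span ℤ _).toAddSubgroup).2 Submodule.subset_span
  exact ((Set.countable_range _).mono hle).to_subtype

/-- Clamping: arguments off the interval `[0, len g]` are moved to its nearest end. -/
theorem apply_clamp {f : H → ℚ → ℚ} (hf : f ∈ starGroup H) (g : H) (t : ℚ) :
    f g (max 0 (min t (len g))) = f g t := by
  refine starGroup_induction (p := fun f => f g (max 0 (min t (len g))) = f g t)
    (fun _ => rfl) (fun h c hc => ?_) (fun f f' hf hf' => ?_) (fun f hf => ?_) hf
  · by_cases hg : g = h
    · subst hg
      have := len_pos g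
      rw [ramp_self, ramp_self]
      rcases le_total t (len g) with h1 | h1 <;> rcases le_total 0 t with h2 | h2 <;>
        grind
    · rw [ramp_of_ne hg, ramp_of_ne hg]
  · simp only [Pi.add_apply, hf, hf']
  · simp only [Pi.neg_apply, hf]

/-- The arms are glued at the centre. -/
theorem apply_zero_eq {f : H → ℚ → ℚ} (hf : f ∈ starGroup H) (g h : H) : f g 0 = f h 0 := by
  have hr : ∀ (k : H) (c : ℚ), 0 ≤ c → ∀ g, ramp k c g 0 = 0 := by
    intro k c hc g
    have := len_pos k
    unfold ramp; split_ifs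
    · rw [min_eq_left this.le, max_eq_left (by linarith)]
    · rfl
  refine starGroup_induction (p := fun f => f g 0 = f h 0)
    (fun _ => rfl) (fun k c hc => ?_) (fun f f' hf hf' => ?_) (fun f hf => ?_) hf
  · rw [hr k c hc, hr k c hc]
  · simp only [Pi.add_apply, hf, hf']
  · simp only [Pi.neg_apply, hf]

theorem finite_not_const {f : H → ℚ → ℚ} (hf : f ∈ starGroup H) :
    {g : H | ¬ ∀ t, f g t = f g 0}.Finite := by
  refine starGroup_induction (p := fun f => {g : H | ¬ ∀ t, f g t = f g 0}.Finite)
    (fun a => ?_) (fun k c hc => ?_) (fun f f' hf hf' => ?_) (fun f hf => ?_) hf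
  · simp [starConst]
  · refine (Set.finite_singleton k).subset fun g hg => ?_
    by_contra hk
    exact hg fun t => by rw [ramp_of_ne hk, ramp_of_ne hk]
  · refine (hf.union hf').subset fun g hg => ?_
    by_contra hk
    simp only [Set.mem_union, Set.mem_ofPred_eq, not_or, not_not] at hk
    exact hg fun t => by simp only [Pi.add_apply, hk.1 t, hk.2 t]
  · refine hf.subset fun g hg h => hg fun t => by simp only [Pi.neg_apply, h t]

theorem exists_lipschitz {f : H → ℚ → ℚ} (hf : f ∈ starGroup H) :
    ∃ L : ℚ, 0 ≤ L ∧ ∀ g s t, |f g s - f g t| ≤ L * |s - t| := by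
  refine starGroup_induction
    (p := fun f => ∃ L : ℚ, 0 ≤ L ∧ ∀ g s t, |f g s - f g t| ≤ L * |s - t|)
    (fun a => ?_) (fun k c hc => ?_) (fun f f' hf hf' => ?_) (fun f hf => ?_) hf
  · exact ⟨0, le_rfl, fun g s t => by simp [starConst]⟩
  · refine ⟨1, zero_le_one, fun g s t => ?_⟩
    rw [one_mul]
    by_cases hg : g = k
    · subst hg
      rw [ramp_self, ramp_self]
      have h1 := abs_max_sub_max_le_abs (min s (len g) - c) (min t (len g) - c) 0
      have h2 := abs_min_sub_min_le_max s (len g) t (len g)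
      rw [sub_self, abs_zero, max_eq_left (abs_nonneg _)] at h2
      rw [max_comm, max_comm 0]
      refine h1.trans (le_trans (le_of_eq ?_) h2)
      congr 1; ring
    · rw [ramp_of_ne hg, ramp_of_ne hg]; simp
  · obtain ⟨L, h0, hL⟩ := hf
    obtain ⟨L', h0', hL'⟩ := hf'
    refine ⟨L + L', by positivity, fun g s t => ?_⟩
    have := abs_add_le (f g s - f g t) (f' g s - f' g t)
    have h1 := hL g s t
    have h2 := hL' g s t
    calc _ = |(f g s - f g t) + (f' g s - f' g t)| := by
            simp only [Pi.add_apply]; congr 1; ring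
      _ ≤ _ := by linarith
  · obtain ⟨L, h0, hL⟩ := hf
    refine ⟨L, h0, fun g s t => ?_⟩
    have := hL g s t
    rwa [Pi.neg_apply, Pi.neg_apply, Pi.neg_apply, ← neg_sub', abs_neg]

/-- Every function in the group is, for a suitable mesh `1 / N`, affine with an integer slope
between consecutive mesh points of each arm, and so it is for all finer meshes. -/
theorem exists_mesh {f : H → ℚ → ℚ} (hf : f ∈ starGroup H) :
    ∃ N : ℕ, 0 < N ∧ ∀ M : ℕ, 0 < M → N ∣ M → ∀ (g : H) (j : ℤ), ∃ (a : ℚ) (k : ℤ),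
      ∀ t : ℚ, j ≤ M * t → M * t ≤ j + 1 → f g t = a + k * t := by
  refine starGroup_induction (p := fun f => ∃ N : ℕ, 0 < N ∧ ∀ M : ℕ, 0 < M → N ∣ M →
      ∀ (g : H) (j : ℤ), ∃ (a : ℚ) (k : ℤ), ∀ t : ℚ, j ≤ M * t → M * t ≤ j + 1 → f g t = a + k * t)
    (fun a => ?_) (fun h c hc => ?_) (fun f f' hf hf' => ?_) (fun f hf => ?_) hf
  · exact ⟨1, one_pos, fun M _ _ g j => ⟨a, 0, fun t _ _ => by simp [starConst]⟩⟩
  · refine ⟨c.den * (len h).den, by positivity, fun M hM0 hM g j => ?_⟩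
    by_cases hg : g = h
    · subst hg
      obtain ⟨d, rfl⟩ := hM
      have hcd : (c.den : ℚ) * c = c.num := by rw [mul_comm]; exact Rat.mul_den_eq_num c
      have hgd : ((len g).den : ℚ) * len g = (len g).num := by
        rw [mul_comm]; exact Rat.mul_den_eq_num (len g)
      set M : ℕ := c.den * (len g).den * d with hMdef
      have hMc : (M : ℚ) * c = (c.num * (len g).den * d : ℤ) := by
        push_cast [hMdef]; rw [← hcd]; ring
      have hMg : (M : ℚ) * len g = ((len g).num * c.den * d : ℤ) := by
        push_cast [hMdef]; rw [← hgd]; ring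
      generalize (c.num * (len g).den * d : ℤ) = C at hMc
      generalize ((len g).num * c.den * d : ℤ) = G at hMg
      have hM0' : (0 : ℚ) < M := by exact_mod_cast hM0
      have key : ∀ {x y : ℚ}, (M : ℚ) * x ≤ M * y → x ≤ y :=
        fun h => le_of_mul_le_mul_left h hM0'
      rcases le_or_gt G j with hGj | hGj
      · refine ⟨max 0 (len g - c), 0, fun t h1 h2 => ?_⟩
        have : (G : ℚ) ≤ j := by exact_mod_cast hGj
        rw [ramp_self, min_eq_right (key (by linarith))]
        simp
      have hG : ((j : ℚ) + 1) ≤ G := by exact_mod_cast hGj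
      rcases le_or_gt C j with hCj | hCj
      · refine ⟨-c, 1, fun t h1 h2 => ?_⟩
        have : (C : ℚ) ≤ j := by exact_mod_cast hCj
        have hct : c ≤ t := key (by linarith)
        rw [ramp_self, min_eq_left (key (by linarith)), max_eq_right (by linarith)]
        push_cast; ring
      · refine ⟨0, 0, fun t h1 h2 => ?_⟩
        have : ((j : ℚ) + 1) ≤ C := by exact_mod_cast hCj
        have hct : t ≤ c := key (by linarith)
        rw [ramp_self, min_eq_left (key (by linarith)), max_eq_left (by linarith)]
        simp
    · exact ⟨0, 0, fun t _ _ => by rw [ramp_of_ne hg]; simp⟩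
  · obtain ⟨N, h0, hN⟩ := hf
    obtain ⟨N', h0', hN'⟩ := hf'
    refine ⟨N * N', by positivity, fun M hM0 hM g j => ?_⟩
    obtain ⟨a, k, ha⟩ := hN M hM0 (dvd_of_mul_right_dvd hM) g j
    obtain ⟨a', k', ha'⟩ := hN' M hM0 (dvd_of_mul_left_dvd hM) g j
    refine ⟨a + a', k + k', fun t h1 h2 => ?_⟩
    rw [Pi.add_apply, Pi.add_apply, ha t h1 h2, ha' t h1 h2]
    push_cast; ring
  · obtain ⟨N, h0, hN⟩ := hf
    refine ⟨N, h0, fun M hM0 hM g j => ?_⟩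
    obtain ⟨a, k, ha⟩ := hN M hM0 hM g j
    refine ⟨-a, -k, fun t h1 h2 => ?_⟩
    rw [Pi.neg_apply, Pi.neg_apply, ha t h1 h2]
    push_cast; ring

end Star

/-! ### Simplicial subgroups -/

/-- Positive elements with a dual family of positive functionals, up to scaling, span a subgroup
whose induced order is simplicial. -/
theorem exists_simplicial_subgroup {D ι : Type*} [AddCommGroup D] [PartialOrder D]
    [IsOrderedAddMonoid D] [Fintype ι] [DecidableEq ι] (v : ι → D) (hv : ∀ i, 0 ≤ v i)
    (ev : ι → D →+ ℚ) (hev : ∀ i x, 0 ≤ x → 0 ≤ ev i x) (m : ℚ) (hm : 0 < m)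
    (hdual : ∀ i j, ev i (v j) = if i = j then m else 0) :
    ∃ S : AddSubgroup D, (∀ i, v i ∈ S) ∧ ∃ n : ℕ, Nonempty (S ≃+o (Fin n → ℤ)) := by
  let e := Fintype.equivFin ι
  let Φ : (Fin (Fintype.card ι) → ℤ) →+ D :=
    { toFun := fun c => ∑ i, c (e i) • v i
      map_zero' := by simp
      map_add' := fun c d => by simp only [Pi.add_apply, add_smul, Finset.sum_add_distrib] }
  have hΦ : ∀ c, Φ c = ∑ i, c (e i) • v i := fun _ => rfl
  have hevΦ : ∀ c i, ev i (Φ c) = c (e i) * m := by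
    intro c i
    rw [hΦ, map_sum]
    simp [hdual]
  have hpos : ∀ c, 0 ≤ Φ c ↔ 0 ≤ c := by
    refine fun c => ⟨fun h j => ?_, fun h => Finset.sum_nonneg fun i _ => zsmul_nonneg (hv i) (h _)⟩
    have h1 := hev (e.symm j) _ h
    rw [hevΦ, Equiv.apply_symm_apply] at h1
    exact_mod_cast nonneg_of_mul_nonneg_left h1 hm
  have hle : ∀ c d, Φ c ≤ Φ d ↔ c ≤ d := fun c d => by
    rw [← sub_nonneg, ← map_sub, hpos, sub_nonneg]
  have hinj : Function.Injective Φ := fun c d h =>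
    le_antisymm ((hle c d).1 h.le) ((hle d c).1 h.ge)
  refine ⟨Φ.range, fun i => ⟨fun j => if j = e i then 1 else 0, ?_⟩, Fintype.card ι, ⟨?_⟩⟩
  · rw [hΦ]; simp
  · let E : (Fin (Fintype.card ι) → ℤ) ≃+o Φ.range :=
      { AddMonoidHom.ofInjective hinj with map_le_map_iff' := fun {c d} => hle c d }
    exact E.symm

section Star

variable {H : Subgroup {q : ℚ // 0 < q}}

/-- The functions of `starGroup H` with all breakpoints at multiples of `1 / N` and value at the
centre a multiple of `1 / N` that are constant on the arms outside `F`. -/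
def meshGroup (F : Finset H) (N : ℕ) : AddSubgroup (H → ℚ → ℚ) :=
  AddSubgroup.closure ({f | ∃ z : ℤ, f = starConst H (z / N)} ∪
    {f | ∃ h ∈ F, ∃ i : ℕ, f = ramp h (i / N)})

theorem exists_mem_meshGroup {f : H → ℚ → ℚ} (hf : f ∈ starGroup H) :
    ∃ (F : Finset H) (N : ℕ), 0 < N ∧ ∀ F' M, F ⊆ F' → 0 < M → N ∣ M → f ∈ meshGroup F' M := by
  have hden : ∀ (c : ℚ) (d : ℕ), 0 < c.den * d → c = (c.num * d : ℤ) / ((c.den * d : ℕ) : ℚ) := by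
    intro c d h
    have hd : (d : ℚ) ≠ 0 := by
      rintro h0
      rw [Nat.cast_eq_zero] at h0
      simp [h0] at h
    push_cast
    rw [mul_div_mul_right _ _ hd, Rat.num_div_den]
  refine starGroup_induction (p := fun f => ∃ (F : Finset H) (N : ℕ), 0 < N ∧
      ∀ F' M, F ⊆ F' → 0 < M → N ∣ M → f ∈ meshGroup F' M)
    (fun a => ?_) (fun h c hc => ?_) (fun f f' hf hf' => ?_) (fun f hf => ?_) hf
  · refine ⟨∅, a.den, a.den_pos, fun F' M _ hM hd => ?_⟩
    obtain ⟨d, rfl⟩ := hd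
    exact AddSubgroup.subset_closure (Or.inl ⟨_, congrArg _ (hden a d hM)⟩)
  · refine ⟨{h}, c.den, c.den_pos, fun F' M hF hM hd => ?_⟩
    obtain ⟨d, rfl⟩ := hd
    refine AddSubgroup.subset_closure (Or.inr ⟨h, hF (by simp), c.num.toNat * d, congrArg _ ?_⟩)
    have : ((c.num.toNat : ℤ) : ℚ) = c.num := by
      rw [Int.toNat_of_nonneg (Rat.num_nonneg.2 hc)]
    have h2 := hden c d hM
    push_cast at h2 this ⊢
    rw [this]; exact h2
  · obtain ⟨F, N, h0, hF⟩ := hf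
    obtain ⟨F', N', h0', hF'⟩ := hf'
    classical
    exact ⟨F ∪ F', N * N', by positivity, fun G M hG hM hd => add_mem
      (hF G M (Finset.union_subset_left hG) hM (dvd_of_mul_right_dvd hd))
      (hF' G M (Finset.union_subset_right hG) hM (dvd_of_mul_left_dvd hd))⟩
  · obtain ⟨F, N, h0, hF⟩ := hf
    exact ⟨F, N, h0, fun G M hG hM hd => neg_mem (hF G M hG hM hd)⟩

/-- The hat function with peak of height `1 / N` at distance `(j + 1) / N` from the centre of the
arm `h`. -/
def hat (N : ℕ) (h : H) (j : ℕ) : H → ℚ → ℚ :=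
  ramp h (j / N) - (2 : ℤ) • ramp h ((j + 1 : ℕ) / N) + ramp h ((j + 2 : ℕ) / N)

/-- The hat function with peak of height `1 / N` at the centre; it equals `1 / N` on the arms
outside `F`. -/
def centralHat (N : ℕ) (F : Finset H) : H → ℚ → ℚ :=
  starConst H (1 / N) - ∑ h ∈ F, (ramp h 0 - ramp h (1 / N))

theorem hat_mem (N : ℕ) (h : H) (j : ℕ) : hat N h j ∈ starGroup H :=
  add_mem (sub_mem (ramp_mem h (by positivity)) (zsmul_mem (ramp_mem h (by positivity)) _))
    (ramp_mem h (by positivity))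

theorem centralHat_mem (N : ℕ) (F : Finset H) : centralHat N F ∈ starGroup H :=
  sub_mem (starConst_mem _) (sum_mem fun h _ =>
    sub_mem (ramp_mem h le_rfl) (ramp_mem h (by positivity)))

theorem hat_apply_self (N : ℕ) (h : H) (j : ℕ) (t : ℚ) : hat N h j h t =
    max 0 (min t (len h) - j / N) - 2 * max 0 (min t (len h) - (j + 1) / N) +
      max 0 (min t (len h) - (j + 2) / N) := by
  simp [hat, ramp_self]

theorem hat_apply_of_ne (N : ℕ) {g h : H} (hg : g ≠ h) (j : ℕ) (t : ℚ) : hat N h j g t = 0 := by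
  simp [hat, ramp_of_ne hg]

theorem hat_nonneg {N : ℕ} (h : H) (j : ℕ) (g : H) (t : ℚ) : 0 ≤ hat N h j g t := by
  by_cases hg : g = h
  · subst hg
    rw [hat_apply_self, add_div, add_div]
    generalize min t (len g) = x
    have h1 : (0 : ℚ) ≤ 1 / N := by positivity
    have h2 : (2 : ℚ) / N = 1 / N + 1 / N := by ring
    rw [h2]
    generalize (1 : ℚ) / N = d at *
    generalize (j : ℚ) / N = y
    grind
  · rw [hat_apply_of_ne N hg]

theorem hat_apply_mesh {N : ℕ} (hN : 0 < N) (h : H) (j k : ℕ)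
    (hk : ((k + 1 : ℕ) : ℚ) ≤ N * len h) :
    hat N h j h ((k + 1 : ℕ) / N) = if k = j then (1 / N : ℚ) else 0 := by
  have hN' : (0 : ℚ) < N := by exact_mod_cast hN
  rw [hat_apply_self, min_eq_left (by rwa [div_le_iff₀' hN'])]
  simp only [← sub_div]
  have hmax : ∀ x : ℚ, max 0 (x / N) = max 0 x / N := fun x => by
    rw [← max_div_div_right hN'.le, zero_div]
  rw [hmax, hmax, hmax]
  push_cast
  rcases lt_trichotomy k j with h1 | rfl | h1
  · have : (k : ℚ) + 1 ≤ j := by exact_mod_cast h1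
    rw [if_neg h1.ne, max_eq_left (by linarith), max_eq_left (by linarith),
      max_eq_left (by linarith)]
    simp
  · rw [if_pos rfl, max_eq_right (by linarith), max_eq_left (by linarith),
      max_eq_left (by linarith)]
    simp
  · have : (j : ℚ) + 1 ≤ k := by exact_mod_cast h1
    rw [if_neg h1.ne', max_eq_right (by linarith), max_eq_right (by linarith),
      max_eq_right (by linarith)]
    ring

theorem centralHat_apply_of_mem (N : ℕ) {F : Finset H} {g : H} (hg : g ∈ F) (t : ℚ) :
    centralHat N F g t = 1 / N - (ramp g 0 g t - ramp g (1 / N) g t) := by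
  simp only [centralHat, Pi.sub_apply, Finset.sum_apply, starConst]
  rw [Finset.sum_eq_single_of_mem g hg fun h _ hh => by
    rw [ramp_of_ne hh.symm, ramp_of_ne hh.symm, sub_zero]]

theorem centralHat_apply_of_notMem (N : ℕ) {F : Finset H} {g : H} (hg : g ∉ F) (t : ℚ) :
    centralHat N F g t = 1 / N := by
  simp only [centralHat, Pi.sub_apply, Finset.sum_apply, starConst]
  rw [Finset.sum_eq_zero fun h hh => by
    have : g ≠ h := fun e => hg (e ▸ hh)
    rw [ramp_of_ne this, ramp_of_ne this, sub_zero], sub_zero]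

theorem centralHat_nonneg (N : ℕ) (F : Finset H) (g : H) (t : ℚ) : 0 ≤ centralHat N F g t := by
  have h1 : (0 : ℚ) ≤ 1 / N := by positivity
  by_cases hg : g ∈ F
  · rw [centralHat_apply_of_mem N hg, ramp_self, ramp_self]
    grind
  · rwa [centralHat_apply_of_notMem N hg]

theorem centralHat_apply_zero (N : ℕ) (F : Finset H) (g : H) : centralHat N F g 0 = 1 / N := by
  have h1 : (0 : ℚ) ≤ 1 / N := by positivity
  by_cases hg : g ∈ F
  · rw [centralHat_apply_of_mem N hg, ramp_self, ramp_self, min_eq_left (len_pos g).le,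
      max_eq_left (by simp), max_eq_left (by simp)]
    simp
  · exact centralHat_apply_of_notMem N hg 0

theorem hat_apply_zero (N : ℕ) (h : H) (j : ℕ) (g : H) : hat N h j g 0 = 0 := by
  by_cases hg : g = h
  · subst hg
    have : ∀ x : ℚ, 0 ≤ x → max 0 (0 - x) = 0 := fun x hx => max_eq_left (by linarith)
    rw [hat_apply_self, min_eq_left (len_pos g).le, this _ (by positivity), this _ (by positivity),
      this _ (by positivity)]
    simp
  · exact hat_apply_of_ne N hg j 0

theorem centralHat_apply_mesh {N : ℕ} (hN : 0 < N) {F : Finset H} {h : H} (hF : h ∈ F) (k : ℕ)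
    (hk : ((k + 1 : ℕ) : ℚ) ≤ N * len h) : centralHat N F h ((k + 1 : ℕ) / N) = 0 := by
  have hN' : (0 : ℚ) < N := by exact_mod_cast hN
  have h1 : (1 : ℚ) / N ≤ ((k + 1 : ℕ) : ℚ) / N := by
    gcongr; push_cast; linarith [(Nat.cast_nonneg k : (0 : ℚ) ≤ k)]
  have h2 : (0 : ℚ) ≤ 1 / N := by positivity
  rw [centralHat_apply_of_mem N hF, ramp_self, ramp_self, min_eq_left (by rwa [div_le_iff₀' hN'])]
  rw [max_eq_right (by linarith), max_eq_right (by linarith)]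
  ring

/-- When the mesh divides the lengths of all arms in `F`, every subgroup that contains the hat
functions contains all functions with this mesh: ramps are iterated sums of hats. -/
theorem meshGroup_le {N : ℕ} (hN : 0 < N) {F : Finset H} {n : H → ℕ}
    (hn : ∀ h ∈ F, (N : ℚ) * len h = n h) {S : AddSubgroup (H → ℚ → ℚ)}
    (hS : ∀ h ∈ F, ∀ j < n h, hat N h j ∈ S) (hS' : centralHat N F ∈ S) : meshGroup F N ≤ S := by
  have hN' : (0 : ℚ) < N := by exact_mod_cast hN
  have hzero : ∀ h ∈ F, ∀ j : ℕ, n h ≤ j → ramp h (j / N) = 0 := by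
    intro h hh j hj
    have : len h ≤ j / N := by
      rw [le_div_iff₀' hN', hn h hh]; exact_mod_cast hj
    funext g t
    by_cases hg : g = h
    · subst hg
      rw [ramp_self, max_eq_left]
      · rfl
      · linarith [min_le_right t (len g)]
    · exact ramp_of_ne hg _ _
  have hstep : ∀ h ∈ F, ∀ d j : ℕ, n h ≤ j + d →
      ramp h (j / N) - ramp h ((j + 1 : ℕ) / N) ∈ S := by
    intro h hh d
    induction d with
    | zero =>
      intro j hj
      rw [hzero h hh j hj, hzero h hh (j + 1) (by omega), sub_zero]
      exact zero_mem S
    | succ d ih =>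
      intro j hj
      rcases lt_or_ge j (n h) with hjn | hjn
      · have := add_mem (hS h hh j hjn) (ih (j + 1) (by omega))
        rw [hat, add_assoc j 1 1] at this
        convert this using 1
        rw [two_zsmul]; abel
      · rw [hzero h hh j hjn, hzero h hh (j + 1) (by omega), sub_zero]
        exact zero_mem S
  have hramp : ∀ h ∈ F, ∀ d j : ℕ, n h ≤ j + d → ramp h (j / N) ∈ S := by
    intro h hh d
    induction d with
    | zero =>
      intro j hj
      rw [hzero h hh j hj]
      exact zero_mem S
    | succ d ih =>
      intro j hj
      have := add_mem (hstep h hh (d + 1) j hj) (ih (j + 1) (by omega))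
      rwa [sub_add_cancel] at this
  have hconst : starConst H (1 / N) ∈ S := by
    have : starConst H (1 / N) = centralHat N F + ∑ h ∈ F, (ramp h 0 - ramp h (1 / N)) := by
      rw [centralHat, sub_add_cancel]
    rw [this]
    refine add_mem hS' (sum_mem fun h hh => ?_)
    have := hstep h hh (n h) 0 (by omega)
    simpa using this
  refine (AddSubgroup.closure_le _).2 ?_
  rintro f (⟨z, rfl⟩ | ⟨h, hh, i, rfl⟩)
  · have : starConst H (z / N) = z • starConst H (1 / N) := by
      funext g t
      simp [starConst, div_eq_mul_inv]
    rw [this]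
    exact zsmul_mem hconst z
  · exact hramp h hh (n h) i (by omega)

theorem exists_len_mul_eq (F : Finset H) :
    ∃ N : ℕ, 0 < N ∧ ∀ M : ℕ, N ∣ M → ∀ h ∈ F, ∃ n : ℕ, (M : ℚ) * len h = n := by
  refine ⟨∏ h ∈ F, (len h).den, Finset.prod_pos fun h _ => (len h).den_pos, fun M hM h hh => ?_⟩
  obtain ⟨d, rfl⟩ := (Finset.dvd_prod_of_mem (fun h : H => (len h).den) hh).trans hM
  refine ⟨(len h).num.toNat * d, ?_⟩
  have h1 : (((len h).num.toNat : ℤ) : ℚ) = (len h).num := by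
    rw [Int.toNat_of_nonneg (Rat.num_nonneg.2 (len_pos h).le)]
  have h2 := Rat.mul_den_eq_num (len h)
  push_cast at h1 ⊢
  rw [h1, ← h2]; ring

theorem exists_meshGroup_of_finset (s : Finset (starGroup H)) :
    ∃ (F : Finset H) (N : ℕ), 0 < N ∧ ∀ M, 0 < M → N ∣ M → ∀ f ∈ s, f.1 ∈ meshGroup F M := by
  classical
  have : ∀ f : starGroup H, ∃ (F : Finset H) (N : ℕ), 0 < N ∧
      ∀ F' M, F ⊆ F' → 0 < M → N ∣ M → f.1 ∈ meshGroup F' M := fun f => exists_mem_meshGroup f.2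
  choose F N hN hF using this
  exact ⟨s.biUnion F, ∏ f ∈ s, N f, Finset.prod_pos fun f _ => hN f, fun M hM hd f hf =>
    hF f _ M (Finset.subset_biUnion_of_mem F hf) hM ((Finset.dvd_prod_of_mem N hf).trans hd)⟩

/-- Evaluation at a point of the star. -/
def evalAt (g : H) (t : ℚ) : starGroup H →+ ℚ where
  toFun f := f.1 g t
  map_zero' := rfl
  map_add' _ _ := rfl

theorem exists_simplicial_subgroup_starGroup (s : Finset (starGroup H)) :
    ∃ S : AddSubgroup (starGroup H), (s : Set (starGroup H)) ⊆ S ∧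
      ∃ n : ℕ, Nonempty (S ≃+o (Fin n → ℤ)) := by
  classical
  obtain ⟨F, N₁, hN₁, hs⟩ := exists_meshGroup_of_finset s
  obtain ⟨N₂, hN₂, hl⟩ := exists_len_mul_eq F
  set N := N₁ * N₂ with hNdef
  have hN : 0 < N := by positivity
  have hN' : (0 : ℚ) < N := by exact_mod_cast hN
  have hl' := hl N (dvd_mul_left _ _)
  have : ∃ n : H → ℕ, ∀ h ∈ F, (N : ℚ) * len h = n h := by
    choose! n hn using hl'
    exact ⟨n, hn⟩
  obtain ⟨n, hn⟩ := this
  -- The vertices of the mesh: the centre and the multiples of `1 / N` on the arms in `F`.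
  let ι := Option (Σ h : F, Fin (n h))
  obtain ⟨v, hv, hv'⟩ : ∃ v : ι → starGroup H, (v none).1 = centralHat N F ∧
      ∀ x : Σ h : F, Fin (n h), (v (some x)).1 = hat N x.1.1 x.2 :=
    ⟨fun i => i.elim ⟨centralHat N F, centralHat_mem N F⟩ fun x => ⟨_, hat_mem N x.1.1 x.2⟩,
      rfl, fun _ => rfl⟩
  obtain ⟨p, hp, hp'⟩ : ∃ p : ι → H × ℚ, p none = (1, 0) ∧
      ∀ x : Σ h : F, Fin (n h), p (some x) = (x.1.1, (((x.2 : ℕ) + 1 : ℕ) : ℚ) / N) :=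
    ⟨fun i => i.elim (1, 0) fun x => (x.1.1, (((x.2 : ℕ) + 1 : ℕ) : ℚ) / N), rfl, fun _ => rfl⟩
  have hle : ∀ (h : F) (k : Fin (n h)), (((k : ℕ) + 1 : ℕ) : ℚ) ≤ N * len h.1 := fun h k => by
    rw [hn h.1 h.2]; exact_mod_cast k.2
  have hnonneg : ∀ i, 0 ≤ v i := by
    rintro (_ | x) g t
    · change 0 ≤ (v none).1 g t
      rw [hv]; exact centralHat_nonneg N F g t
    · change 0 ≤ (v (some x)).1 g t
      rw [hv']; exact hat_nonneg _ _ g t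
  have hdual : ∀ i j, (v j).1 (p i).1 (p i).2 = if i = j then (1 / N : ℚ) else 0 := by
    rintro (_ | ⟨h, k⟩) (_ | ⟨h', j⟩)
    · rw [hv, hp, centralHat_apply_zero, if_pos rfl]
    · rw [hv', hp, hat_apply_zero, if_neg (by simp)]
    · rw [hv, hp', centralHat_apply_mesh hN h.2 k (hle h k), if_neg (by simp)]
    · rw [hv', hp']
      by_cases hh : h = h'
      · subst hh
        rw [hat_apply_mesh hN _ _ _ (hle h k)]
        by_cases hkj : k = j
        · subst hkj; rw [if_pos rfl, if_pos rfl]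
        · rw [if_neg fun e => hkj (Fin.ext e), if_neg]
          rintro ⟨⟩
          exact hkj rfl
      · rw [hat_apply_of_ne N fun e => hh (Subtype.ext e), if_neg]
        rintro ⟨⟩
        exact hh rfl
  obtain ⟨S, hvS, hS⟩ := exists_simplicial_subgroup v hnonneg
    (fun i => evalAt (p i).1 (p i).2) (fun i f hf => hf _ _) (1 / N) (by positivity) hdual
  refine ⟨S, fun f hf => ?_, hS⟩
  have hmesh : meshGroup F N ≤ S.map (starGroup H).subtype := by
    refine meshGroup_le hN hn (fun h hh j hj => ?_) ?_
    · exact ⟨_, hvS (some ⟨⟨h, hh⟩, ⟨j, hj⟩⟩), hv' _⟩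
    · exact ⟨_, hvS none, hv⟩
  obtain ⟨f', hf', he⟩ := hmesh (hs N hN (dvd_mul_right _ _) f hf)
  rwa [← Subtype.ext he]

/-! ### The action by similarities -/

/-- The similarity of ratio `r` of the star takes the arm `h` onto the arm `r * h`; this is the
induced map on functions, multiplied by `r` so that slopes are kept. -/
def scaleFun (r : H) (f : H → ℚ → ℚ) : H → ℚ → ℚ :=
  fun g t => len r * f (r⁻¹ * g) ((len r)⁻¹ * t)

theorem scaleFun_starConst (r : H) (a : ℚ) :
    scaleFun r (starConst H a) = starConst H (len r * a) := rfl

theorem scaleFun_ramp (r h : H) (c : ℚ) :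
    scaleFun r (ramp h c) = ramp (r * h) (len r * c) := by
  funext g t
  have hr := len_pos r
  unfold scaleFun
  by_cases hg : g = r * h
  · subst hg
    rw [inv_mul_cancel_left, ramp_self, ramp_self, len_mul, mul_max_of_nonneg _ _ hr.le, mul_sub,
      mul_min_of_nonneg _ _ hr.le, mul_zero, mul_inv_cancel_left₀ hr.ne']
  · rw [ramp_of_ne hg, ramp_of_ne fun e => hg (eq_mul_of_inv_mul_eq e), mul_zero]

theorem scaleFun_add (r : H) (f f' : H → ℚ → ℚ) :
    scaleFun r (f + f') = scaleFun r f + scaleFun r f' := by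
  funext g t; simp [scaleFun, mul_add]

theorem scaleFun_neg (r : H) (f : H → ℚ → ℚ) : scaleFun r (-f) = -scaleFun r f := by
  funext g t; simp [scaleFun]

theorem scaleFun_mul (r r' : H) (f : H → ℚ → ℚ) :
    scaleFun (r * r') f = scaleFun r (scaleFun r' f) := by
  funext g t
  simp [scaleFun, len_mul, mul_assoc, mul_comm]

theorem scaleFun_one (f : H → ℚ → ℚ) : scaleFun 1 f = f := by
  funext g t; simp [scaleFun, len_one]

theorem scaleFun_mem (r : H) {f : H → ℚ → ℚ} (hf : f ∈ starGroup H) :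
    scaleFun r f ∈ starGroup H := by
  refine starGroup_induction (p := fun f => scaleFun r f ∈ starGroup H)
    (fun a => ?_) (fun k c hc => ?_) (fun f f' hf hf' => ?_) (fun f hf => ?_) hf
  · rw [scaleFun_starConst]; exact starConst_mem _
  · rw [scaleFun_ramp]
    exact ramp_mem _ (mul_nonneg (len_pos r).le hc)
  · rw [scaleFun_add]; exact add_mem hf hf'
  · rw [scaleFun_neg]; exact neg_mem hf

theorem scaleFun_mono (r : H) {f f' : H → ℚ → ℚ} (h : f ≤ f') : scaleFun r f ≤ scaleFun r f' :=
  fun _ _ => mul_le_mul_of_nonneg_left (h _ _) (len_pos r).le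

/-- The order automorphism of the group of functions induced by a similarity of the star. -/
def scaleIso (r : H) : starGroup H ≃o starGroup H where
  toFun f := ⟨scaleFun r f.1, scaleFun_mem r f.2⟩
  invFun f := ⟨scaleFun r⁻¹ f.1, scaleFun_mem r⁻¹ f.2⟩
  left_inv f := Subtype.ext (by
    change scaleFun r⁻¹ (scaleFun r f.1) = f.1
    rw [← scaleFun_mul, inv_mul_cancel, scaleFun_one])
  right_inv f := Subtype.ext (by
    change scaleFun r (scaleFun r⁻¹ f.1) = f.1
    rw [← scaleFun_mul, mul_inv_cancel, scaleFun_one])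
  map_rel_iff' {f f'} := by
    refine ⟨fun h => ?_, fun h => scaleFun_mono r h⟩
    have := scaleFun_mono r⁻¹ (show scaleFun r f.1 ≤ scaleFun r f'.1 from h)
    rwa [← scaleFun_mul, ← scaleFun_mul, inv_mul_cancel, scaleFun_one, scaleFun_one] at this

/-- The action of `H` on the group of functions by automorphisms of the ordered group. -/
def scaleHom : H →* orderAut (starGroup H) where
  toFun r := ⟨scaleIso r, fun f f' => Subtype.ext (scaleFun_add r f.1 f'.1)⟩
  map_one' := Subtype.ext (RelIso.ext fun f => Subtype.ext (scaleFun_one f.1))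
  map_mul' r r' := Subtype.ext (RelIso.ext fun f => Subtype.ext (scaleFun_mul r r' f.1))

/-! ### Evaluations and the order -/

/-- The inclusion of the rational numbers as constant functions on the star. -/
def constHom (H : Subgroup {q : ℚ // 0 < q}) : ℚ →+ starGroup H where
  toFun a := ⟨starConst H a, starConst_mem a⟩
  map_zero' := rfl
  map_add' _ _ := rfl

/-- The distance to the centre on the arm `h`, extended by zero to the other arms. -/
def armCoord (h : H) : starGroup H := ⟨ramp h 0, ramp_mem h le_rfl⟩

/-- For `0 ≤ t ≤ len h`, the absolute value of `armCoord h - t`; on the arm `h` it is the distance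
to the point at `t`. -/
def peak (h : H) (t : ℚ) (ht : 0 ≤ t) : starGroup H :=
  constHom H t - armCoord h + 2 • ⟨ramp h t, ramp_mem h ht⟩

theorem armCoord_nonneg (h g : H) (x : ℚ) : 0 ≤ (armCoord h).1 g x := ramp_nonneg h 0 g x

theorem armCoord_self {h : H} {t : ℚ} (h0 : 0 ≤ t) (ht : t ≤ len h) : (armCoord h).1 h t = t :=
  ramp_zero_self h0 ht

theorem armCoord_of_ne {g h : H} (hg : g ≠ h) (x : ℚ) : (armCoord h).1 g x = 0 :=
  ramp_of_ne hg 0 x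

theorem armCoord_le (h g : H) (x : ℚ) : (armCoord h).1 g x ≤ len h := by
  by_cases hg : g = h
  · subst hg
    change ramp g 0 g x ≤ _
    rw [ramp_self]
    exact max_le (len_pos g).le (by linarith [min_le_right x (len g)])
  · rw [armCoord_of_ne hg]; exact (len_pos h).le

theorem peak_apply (h : H) {t : ℚ} (h0 : 0 ≤ t) (ht : t ≤ len h) (g : H) (x : ℚ) :
    (peak h t h0).1 g x = |(armCoord h).1 g x - t| := by
  change t - ramp h 0 g x + (2 • ramp h t) g x = |ramp h 0 g x - t|
  rw [two_nsmul, Pi.add_apply, Pi.add_apply]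
  by_cases hg : g = h
  · subst hg
    rw [ramp_self, ramp_self]
    grind
  · rw [ramp_of_ne hg, ramp_of_ne hg, zero_sub, abs_neg, abs_of_nonneg h0]; ring

/-- Nonnegative functions that vanish at the point `t` of the arm `h` and dominate, up to
multiples, all functions vanishing there. -/
def nearCone (h : H) (t : ℚ) (ht : 0 ≤ t) : AddSubmonoid (starGroup H) :=
  AddSubmonoid.closure ({peak h t ht} ∪ {e | ∃ k, k ≠ h ∧ e = armCoord k})

theorem exists_mem_nearCone {f : H → ℚ → ℚ} (hf : f ∈ starGroup H) (h : H) {t : ℚ} (h0 : 0 ≤ t)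
    (ht : t ≤ len h) : ∃ e ∈ nearCone h t h0, ∀ g x, |f g x - f h t| ≤ e.1 g x := by
  refine starGroup_induction
    (p := fun f => ∃ e ∈ nearCone h t h0, ∀ g x, |f g x - f h t| ≤ e.1 g x)
    (fun a => ?_) (fun k c hc => ?_) (fun f f' hf hf' => ?_) (fun f hf => ?_) hf
  · exact ⟨0, zero_mem _, fun g x => by simp [starConst]⟩
  · by_cases hk : k = h
    · subst hk
      refine ⟨_, AddSubmonoid.subset_closure (Or.inl rfl), fun g x => ?_⟩
      rw [peak_apply k h0 ht]
      change _ ≤ |ramp k 0 g x - t|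
      by_cases hg : g = k
      · subst hg
        rw [ramp_self, ramp_self, ramp_self]
        grind
      · rw [ramp_of_ne hg, ramp_of_ne hg, ramp_self]
        grind
    · refine ⟨_, AddSubmonoid.subset_closure (Or.inr ⟨k, hk, rfl⟩), fun g x => ?_⟩
      change _ ≤ ramp k 0 g x
      rw [ramp_of_ne (Ne.symm hk)]
      by_cases hg : g = k
      · subst hg
        rw [ramp_self, ramp_self]
        grind
      · rw [ramp_of_ne hg, ramp_of_ne hg]; simp
  · obtain ⟨e, he, hfe⟩ := hf
    obtain ⟨e', he', hfe'⟩ := hf'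
    refine ⟨e + e', add_mem he he', fun g x => ?_⟩
    calc _ = |(f g x - f h t) + (f' g x - f' h t)| := by
            simp only [Pi.add_apply]; congr 1; ring
      _ ≤ _ := (abs_add_le _ _).trans (add_le_add (hfe g x) (hfe' g x))
  · obtain ⟨e, he, hfe⟩ := hf
    refine ⟨e, he, fun g x => ?_⟩
    rw [Pi.neg_apply, Pi.neg_apply, Pi.neg_apply, Pi.neg_apply, ← neg_sub', abs_neg]
    exact hfe g x

theorem apply_eq_zero_of_mem_nearCone {h : H} {t : ℚ} {h0 : 0 ≤ t} (ht : t ≤ len h)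
    {e : starGroup H} (he : e ∈ nearCone h t h0) : e.1 h t = 0 := by
  induction he using AddSubmonoid.closure_induction with
  | mem e he =>
    rcases he with rfl | ⟨k, hk, rfl⟩
    · rw [peak_apply h h0 ht, armCoord_self h0 ht, sub_self, abs_zero]
    · exact armCoord_of_ne hk.symm t
  | zero => rfl
  | add e e' _ _ he he' =>
    change e.1 h t + e'.1 h t = 0
    rw [he, he', add_zero]

/-- Suprema `f ⊔ -f` in the group are pointwise, so evaluations commute with them. -/
theorem isLUB_apply {f m : starGroup H} (hm : IsLUB {f, -f} m) (h : H) {t : ℚ} (h0 : 0 ≤ t)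
    (ht : t ≤ len h) : m.1 h t = |f.1 h t| := by
  apply le_antisymm
  · obtain ⟨e, he, hfe⟩ := exists_mem_nearCone f.2 h h0 ht
    have hle : m ≤ constHom H |f.1 h t| + e := by
      refine hm.2 ?_
      have key : ∀ g x, |f.1 g x| ≤ |f.1 h t| + e.1 g x := fun g x => by
        have := abs_sub_abs_le_abs_sub (f.1 g x) (f.1 h t)
        linarith [hfe g x]
      rintro _ (rfl | rfl) g x
      · exact (le_abs_self _).trans (key g x)
      · exact (neg_le_abs _).trans (key g x)
    have := hle h t
    change m.1 h t ≤ |f.1 h t| + e.1 h t at this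
    rwa [apply_eq_zero_of_mem_nearCone ht he, add_zero] at this
  · exact abs_le'.2 ⟨hm.1 (Or.inl rfl) h t, hm.1 (Or.inr rfl) h t⟩

theorem isLUB_of_apply {f m : starGroup H} (hm : ∀ g x, m.1 g x = |f.1 g x|) :
    IsLUB {f, -f} m := by
  refine ⟨?_, fun d hd g x => ?_⟩
  · rintro _ (rfl | rfl) g x
    · exact (le_abs_self _).trans (hm g x).ge
    · exact (neg_le_abs _).trans (hm g x).ge
  · change m.1 g x ≤ d.1 g x
    rw [hm]
    exact abs_le'.2 ⟨hd (Or.inl rfl) g x, hd (Or.inr rfl) g x⟩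

theorem isOrderUnit_constHom_one : IsOrderUnit (constHom H 1) := by
  have hpos : ∀ {n : ℚ}, 0 < n → 0 < constHom H n := fun hn =>
    lt_of_le_of_ne (fun _ _ => hn.le)
      fun h => hn.ne (congrFun (congrFun (congrArg Subtype.val h) 1) 0)
  refine ⟨hpos one_pos, fun f => ?_⟩
  obtain ⟨L, hL⟩ : ∃ L : ℚ, ∀ g x, f.1 g x ≤ L := by
    refine starGroup_induction (p := fun f => ∃ L : ℚ, ∀ g x, |f g x| ≤ L) (fun a => ?_)
      (fun k c hc => ?_) (fun f f' hf hf' => ?_) (fun f hf => ?_) f.2 |>.imp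
      fun L hL g x => (le_abs_self _).trans (hL g x)
    · exact ⟨|a|, fun _ _ => le_rfl⟩
    · refine ⟨len k, fun g x => ?_⟩
      rw [abs_of_nonneg (ramp_nonneg k c g x)]
      have := len_pos k
      by_cases hg : g = k
      · subst hg; rw [ramp_self]; grind
      · rw [ramp_of_ne hg]; exact this.le
    · obtain ⟨L, hL⟩ := hf
      obtain ⟨L', hL'⟩ := hf'
      exact ⟨L + L', fun g x => (abs_add_le _ _).trans (add_le_add (hL g x) (hL' g x))⟩
    · obtain ⟨L, hL⟩ := hf
      exact ⟨L, fun g x => by rw [Pi.neg_apply, Pi.neg_apply, abs_neg]; exact hL g x⟩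
  refine ⟨⌈L⌉₊ + 1, by omega, fun g x => ?_⟩
  rw [← map_nsmul]
  change f.1 g x ≤ (⌈L⌉₊ + 1) • (1 : ℚ)
  rw [nsmul_one]
  push_cast
  linarith [hL g x, Nat.le_ceil L]

/-! ### Divisible elements -/

/-- Slopes are integers, so an element divisible by all positive integers has slope zero. -/
theorem eq_const_of_divisible {f : starGroup H}
    (hf : ∀ n : ℕ, 0 < n → ∃ f' : starGroup H, n • f' = f) : ∃ a, f = constHom H a := by
  obtain ⟨N, hN, hmesh⟩ := exists_mesh f.2
  have hN' : (0 : ℚ) < N := by exact_mod_cast hN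
  have hpiece : ∀ (g : H) (j : ℤ), ∃ a : ℚ, ∀ t : ℚ, j ≤ N * t → N * t ≤ j + 1 → f.1 g t = a := by
    intro g j
    obtain ⟨a, k, hk⟩ := hmesh N hN dvd_rfl g j
    obtain ⟨f', hf'⟩ := hf (k.natAbs + 1) (by omega)
    obtain ⟨N', hN0', hmesh'⟩ := exists_mesh f'.2
    obtain ⟨a', k', hk'⟩ := hmesh' (N * N') (by positivity) (dvd_mul_left _ _) g (j * N')
    have hN'' : (0 : ℚ) < N' := by exact_mod_cast hN0'
    have hN1 : (1 : ℚ) ≤ N' := by exact_mod_cast hN0'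
    have hff : ∀ t, f.1 g t = (k.natAbs + 1 : ℕ) * f'.1 g t := fun t => by
      rw [← hf', ← nsmul_eq_mul]; rfl
    -- Compare the slopes of `f` and `f'` on the first piece of the finer mesh.
    have e1 : (N : ℚ) * (j / N) = j := by field_simp
    have e2 : (N : ℚ) * (j / N + 1 / (N * N')) = j + 1 / N' := by field_simp
    have h1 : (1 : ℚ) / N' ≤ 1 := by rw [div_le_one hN'']; exact hN1
    have h2 : (0 : ℚ) ≤ 1 / N' := by positivity
    have A := hk (j / N) (by rw [e1]) (by rw [e1]; linarith)
    have B := hk (j / N + 1 / (N * N')) (by rw [e2]; linarith) (by rw [e2]; linarith)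
    have e3 : ((N * N' : ℕ) : ℚ) * (j / N) = j * N' := by push_cast; field_simp
    have e4 : ((N * N' : ℕ) : ℚ) * (j / N + 1 / (N * N')) = j * N' + 1 := by push_cast; field_simp
    have C := hk' (j / N) (by rw [e3]; push_cast; exact le_rfl) (by rw [e3]; push_cast; linarith)
    have D := hk' (j / N + 1 / (N * N')) (by rw [e4]; push_cast; linarith)
      (by rw [e4]; push_cast; exact le_rfl)
    rw [hff, C] at A
    rw [hff, D] at B
    have hd : (1 : ℚ) / (N * N') ≠ 0 := by positivity
    have hkk : ((k.natAbs + 1 : ℕ) : ℚ) * k' = k := mul_right_cancel₀ hd (by linarith)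
    have hkk' : ((k.natAbs + 1 : ℕ) : ℤ) * k' = k :=
      Int.cast_injective (α := ℚ) (by rw [Int.cast_mul, Int.cast_natCast]; exact hkk)
    have hk0 : k = 0 := by
      refine Int.eq_zero_of_abs_lt_dvd (Dvd.intro _ hkk') ?_
      rw [Int.abs_eq_natAbs]; omega
    subst hk0
    exact ⟨a, fun t h1 h2 => by rw [hk t h1 h2]; simp⟩
  have hvert : ∀ (g : H) (j : ℕ), f.1 g (j / N) = f.1 g 0 := by
    intro g j
    induction j with
    | zero => simp
    | succ j ih =>
      obtain ⟨a, ha⟩ := hpiece g j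
      have e1 : (N : ℚ) * (j / N) = j := by field_simp
      have e2 : (N : ℚ) * ((j + 1 : ℕ) / N) = j + 1 := by push_cast; field_simp
      rw [← ih, ha _ (by rw [e2]; push_cast; linarith) (by rw [e2]; push_cast; linarith),
        ha _ (by rw [e1]; push_cast; linarith) (by rw [e1]; push_cast; linarith)]
  have hconst : ∀ (g : H) (t : ℚ), 0 ≤ t → f.1 g t = f.1 g 0 := by
    intro g t ht
    rw [← hvert g ⌊(N : ℚ) * t⌋₊]
    obtain ⟨a, ha⟩ := hpiece g ⌊(N : ℚ) * t⌋₊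
    have e1 : (N : ℚ) * (⌊(N : ℚ) * t⌋₊ / N) = ⌊(N : ℚ) * t⌋₊ := by field_simp
    have h1 := Nat.floor_le (mul_nonneg hN'.le ht)
    have h2 := (Nat.lt_floor_add_one ((N : ℚ) * t)).le
    rw [ha t (by exact_mod_cast h1) (by exact_mod_cast h2),
      ha _ (by rw [e1]; simp) (by rw [e1]; push_cast; linarith)]
  refine ⟨f.1 1 0, Subtype.ext (funext fun g => funext fun t => ?_)⟩
  rw [← apply_clamp f.2, hconst g _ (le_max_left _ _), apply_zero_eq f.2 g 1]
  rfl

theorem exists_map_constHom (E : starGroup H ≃+o starGroup H) :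
    ∃ r : ℚ, 0 < r ∧ ∀ a, E (constHom H a) = constHom H (r * a) := by
  have hE : ∀ a, ∃ b, E (constHom H a) = constHom H b := fun a => by
    refine eq_const_of_divisible fun n hn => ⟨E (constHom H (a / n)), ?_⟩
    have : (n : ℚ) ≠ 0 := by positivity
    rw [← map_nsmul, ← map_nsmul, nsmul_eq_mul, mul_div_cancel₀ _ this]
  let ρ : ℚ →+ ℚ := (evalAt 1 0).comp ((E : starGroup H →+ starGroup H).comp (constHom H))
  have hρ : ∀ a, E (constHom H a) = constHom H (ρ a) := fun a => by
    obtain ⟨b, hb⟩ := hE a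
    have : ρ a = b := congrArg (evalAt 1 0) hb
    rw [this, hb]
  have hlin : ∀ a, ρ a = ρ 1 * a := fun a => by
    have := map_rat_smul ρ a (1 : ℚ)
    rwa [smul_eq_mul, smul_eq_mul, mul_one, mul_comm] at this
  refine ⟨ρ 1, ?_, fun a => by rw [hρ, hlin]⟩
  have h1 : 0 ≤ E (constHom H 1) := by
    rw [← map_zero E]
    exact (map_le_map_iff E).2 isOrderUnit_constHom_one.1.le
  rw [hρ] at h1
  refine lt_of_le_of_ne (h1 1 0) fun h0 => isOrderUnit_constHom_one.1.ne' (a := constHom H 1) ?_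
  apply EquivLike.injective E
  rw [hρ, ← h0, map_zero, map_zero]

/-! ### Rigidity -/

theorem map_apply_abs (E : starGroup H ≃+o starGroup H) {f m : starGroup H}
    (hm : ∀ g x, m.1 g x = |f.1 g x|) (h : H) {t : ℚ} (h0 : 0 ≤ t) (ht : t ≤ len h) :
    (E m).1 h t = |(E f).1 h t| := by
  refine isLUB_apply ?_ h h0 ht
  have := (OrderIsoClass.toOrderIso E).isLUB_image'.2 (isLUB_of_apply hm)
  rw [Set.image_pair] at this
  rw [← map_neg]
  exact this

/-- An automorphism followed by evaluation at a point of the star is, up to the factor by which the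
automorphism multiplies constants, evaluation at a point of the star: both are lattice
homomorphisms, and a lattice homomorphism is determined by its values on arm coordinates, of which
at most one is nonzero. -/
theorem exists_point (E : starGroup H ≃+o starGroup H) {r : ℚ} (hr : 0 < r)
    (hE : ∀ a, E (constHom H a) = constHom H (r * a)) (h : H) {t : ℚ} (h0 : 0 ≤ t)
    (ht : t ≤ len h) :
    ∃ (h' : H) (t' : ℚ), 0 ≤ t' ∧ t' ≤ len h' ∧ ∀ f, (E f).1 h t = r * f.1 h' t' := by
  have hmono : ∀ f f' : starGroup H, (∀ g x, f.1 g x ≤ f'.1 g x) → (E f).1 h t ≤ (E f').1 h t :=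
    fun f f' hf => (map_le_map_iff E).2 (show f ≤ f' from hf) h t
  have hnonneg : ∀ k, 0 ≤ (E (armCoord k)).1 h t := fun k => by
    have := hmono 0 (armCoord k) (armCoord_nonneg k)
    rwa [map_zero] at this
  have hdisj : ∀ k k', k ≠ k' → 0 < (E (armCoord k)).1 h t → (E (armCoord k')).1 h t = 0 := by
    intro k k' hk hpos
    have h1 : ∀ g x, (armCoord k + armCoord k').1 g x = |(armCoord k - armCoord k').1 g x| := by
      intro g x
      change (armCoord k).1 g x + (armCoord k').1 g x = |(armCoord k).1 g x - (armCoord k').1 g x|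
      by_cases hg : g = k
      · rw [armCoord_of_ne (h := k') (by rw [hg]; exact hk), add_zero, sub_zero,
          abs_of_nonneg (armCoord_nonneg k g x)]
      · rw [armCoord_of_ne hg, zero_add, zero_sub, abs_neg, abs_of_nonneg (armCoord_nonneg k' g x)]
    have h2 := map_apply_abs E h1 h h0 ht
    rw [map_add, map_sub] at h2
    change (E (armCoord k)).1 h t + (E (armCoord k')).1 h t =
      |(E (armCoord k)).1 h t - (E (armCoord k')).1 h t| at h2
    have h3 := hnonneg k'
    rcases abs_cases ((E (armCoord k)).1 h t - (E (armCoord k')).1 h t) with h4 | h4 <;> linarith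
  obtain ⟨h', hh'⟩ : ∃ h', ∀ k, k ≠ h' → (E (armCoord k)).1 h t = 0 := by
    by_cases hex : ∃ k, 0 < (E (armCoord k)).1 h t
    · obtain ⟨k, hk⟩ := hex
      exact ⟨k, fun k' hk' => hdisj k k' hk'.symm hk⟩
    · push Not at hex
      exact ⟨1, fun k _ => le_antisymm (hex k) (hnonneg k)⟩
  set t' := (E (armCoord h')).1 h t / r with ht'
  have hrt : r * t' = (E (armCoord h')).1 h t := mul_div_cancel₀ _ hr.ne'
  have h0' : 0 ≤ t' := div_nonneg (hnonneg h') hr.le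
  have hlen : t' ≤ len h' := by
    have := hmono (armCoord h') (constHom H (len h')) (fun g x => armCoord_le h' g x)
    rw [hE, ← hrt] at this
    exact le_of_mul_le_mul_left this hr
  have hcone : ∀ e ∈ nearCone h' t' h0', (E e).1 h t = 0 := by
    intro e he
    induction he using AddSubmonoid.closure_induction with
    | mem e he =>
      rcases he with rfl | ⟨k, hk, rfl⟩
      · rw [map_apply_abs E (f := armCoord h' - constHom H t')
          (fun g x => peak_apply h' h0' hlen g x) h h0 ht, map_sub, hE]
        change |(E (armCoord h')).1 h t - r * t'| = 0
        rw [hrt, sub_self, abs_zero]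
      · exact hh' k hk
    | zero => rw [map_zero]; rfl
    | add e e' _ _ he he' =>
      rw [map_add]
      change (E e).1 h t + (E e').1 h t = 0
      rw [he, he', add_zero]
  refine ⟨h', t', h0', hlen, fun f => ?_⟩
  obtain ⟨e, he, hfe⟩ := exists_mem_nearCone f.2 h' h0' hlen
  have h1 := hmono (f - constHom H (f.1 h' t')) e fun g x => (le_abs_self _).trans (hfe g x)
  have h2 := hmono (constHom H (f.1 h' t') - f) e fun g x => by
    have := hfe g x
    rw [abs_sub_comm] at this
    exact (le_abs_self _).trans this
  rw [map_sub, hE, hcone e he] at h1 h2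
  change (E f).1 h t - r * f.1 h' t' ≤ 0 at h1
  change r * f.1 h' t' - (E f).1 h t ≤ 0 at h2
  linarith

/-- The functions `E f` separate points of each arm. -/
theorem map_separates (E : starGroup H ≃+o starGroup H) (g : H) {s t : ℚ} (hs : 0 ≤ s)
    (hsg : s ≤ len g) (ht : 0 ≤ t) (htg : t ≤ len g) (h : ∀ f, (E f).1 g s = (E f).1 g t) :
    s = t := by
  have := h (E.symm (armCoord g))
  rwa [OrderAddMonoidIso.apply_symm_apply, armCoord_self hs hsg, armCoord_self ht htg] at this

/-- Automorphisms fix the centre: otherwise some `E (armCoord h)` would be nonzero at the centre,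
hence constant and nonzero on almost all arms, and each of these would be mapped to a point. -/
theorem map_armCoord_zero [Infinite H] (E : starGroup H ≃+o starGroup H) {r : ℚ} (hr : 0 < r)
    (hE : ∀ a, E (constHom H a) = constHom H (r * a)) (h g : H) : (E (armCoord h)).1 g 0 = 0 := by
  by_contra hne
  obtain ⟨k, hk⟩ := (finite_not_const (E (armCoord h)).2).infinite_compl.nonempty
  have hk' : ∀ t, (E (armCoord h)).1 k t = (E (armCoord h)).1 k 0 := by
    simpa using hk
  rw [apply_zero_eq (E (armCoord h)).2 g k] at hne
  obtain ⟨h₁, t₁, h0₁, hl₁, hf₁⟩ := exists_point E hr hE k le_rfl (len_pos k).le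
  obtain ⟨h₂, t₂, h0₂, hl₂, hf₂⟩ := exists_point E hr hE k (len_pos k).le le_rfl
  have e₁ := hf₁ (armCoord h)
  have e₂ := hf₂ (armCoord h)
  have k₁ : h₁ = h := by
    by_contra hh
    rw [armCoord_of_ne hh, mul_zero] at e₁
    exact hne e₁
  have k₂ : h₂ = h := by
    by_contra hh
    rw [hk', armCoord_of_ne hh, mul_zero] at e₂
    exact hne e₂
  subst k₁
  subst k₂
  rw [armCoord_self h0₁ hl₁] at e₁
  rw [armCoord_self h0₂ hl₂, hk', e₁] at e₂
  have e₃ := mul_left_cancel₀ hr.ne' e₂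
  subst e₃
  exact (len_pos k).ne (map_separates E k le_rfl (len_pos k).le (len_pos k).le le_rfl
    fun f => by rw [hf₁, hf₂])

/-- Away from the centre, on a given arm, the function `E (armCoord h)` is injective where it is
positive. -/
theorem map_armCoord_injOn (E : starGroup H ≃+o starGroup H) {r : ℚ} (hr : 0 < r)
    (hE : ∀ a, E (constHom H a) = constHom H (r * a)) (h g : H) {s t : ℚ} (hs : 0 ≤ s)
    (hsg : s ≤ len g) (ht : 0 ≤ t) (htg : t ≤ len g) (hpos : 0 < (E (armCoord h)).1 g s)
    (heq : (E (armCoord h)).1 g s = (E (armCoord h)).1 g t) : s = t := by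
  obtain ⟨h₁, t₁, h0₁, hl₁, hf₁⟩ := exists_point E hr hE g hs hsg
  obtain ⟨h₂, t₂, h0₂, hl₂, hf₂⟩ := exists_point E hr hE g ht htg
  have e₁ := hf₁ (armCoord h)
  have e₂ := hf₂ (armCoord h)
  have k₁ : h₁ = h := by
    by_contra hh
    rw [armCoord_of_ne hh, mul_zero] at e₁
    exact hpos.ne' e₁
  have k₂ : h₂ = h := by
    by_contra hh
    rw [← heq, armCoord_of_ne hh, mul_zero] at e₂
    exact hpos.ne' e₂
  subst k₁
  subst k₂
  rw [armCoord_self h0₁ hl₁] at e₁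
  rw [armCoord_self h0₂ hl₂, ← heq, e₁] at e₂
  have e₃ := mul_left_cancel₀ hr.ne' e₂
  subst e₃
  exact map_separates E g hs hsg ht htg fun f => by rw [hf₁, hf₂]

/-- Away from the centre, the zero set of `E (armCoord h)` on an arm is open: near a zero another
`E (armCoord k)` is positive. -/
theorem map_armCoord_zero_nhds [Infinite H] (E : starGroup H ≃+o starGroup H) {r : ℚ} (hr : 0 < r)
    (hE : ∀ a, E (constHom H a) = constHom H (r * a)) (h g : H) {t : ℚ} (ht : 0 < t)
    (htg : t ≤ len g) (hzero : (E (armCoord h)).1 g t = 0) :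
    ∃ δ : ℚ, 0 < δ ∧ ∀ s, 0 ≤ s → s ≤ len g → |s - t| < δ → (E (armCoord h)).1 g s = 0 := by
  obtain ⟨k, x, h0, hl, hf⟩ := exists_point E hr hE g ht.le htg
  have hx : x ≠ 0 := by
    rintro rfl
    obtain ⟨k', x', h0', hl', hf'⟩ := exists_point E hr hE g le_rfl (len_pos g).le
    have := hf' (armCoord k')
    rw [map_armCoord_zero E hr hE, armCoord_self h0' hl', eq_comm, mul_eq_zero,
      or_iff_right hr.ne'] at this
    subst this
    exact ht.ne (map_separates E g le_rfl (len_pos g).le ht.le htg fun f => by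
      rw [hf, hf', apply_zero_eq f.2 k' k])
  have hx' : 0 < x := lt_of_le_of_ne h0 hx.symm
  have hkpos : 0 < (E (armCoord k)).1 g t := by
    rw [hf, armCoord_self h0 hl]; positivity
  have hkh : k ≠ h := by
    rintro rfl
    exact hkpos.ne' hzero
  obtain ⟨L, hL0, hL⟩ := exists_lipschitz (E (armCoord k)).2
  refine ⟨(E (armCoord k)).1 g t / (L + 1), by positivity, fun s hs hsg hst => ?_⟩
  have hspos : 0 < (E (armCoord k)).1 g s := by
    rw [lt_div_iff₀ (by positivity)] at hst
    have h1 := hL g s t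
    have h2 := abs_nonneg (s - t)
    have h3 := neg_abs_le ((E (armCoord k)).1 g s - (E (armCoord k)).1 g t)
    nlinarith
  obtain ⟨k', x', h0', hl', hf'⟩ := exists_point E hr hE g hs hsg
  rw [hf'] at hspos ⊢
  by_cases hk' : k' = k
  · rw [armCoord_of_ne (by rw [hk']; exact hkh), mul_zero]
  · rw [armCoord_of_ne hk', mul_zero] at hspos
    exact absurd hspos (lt_irrefl 0)

theorem map_armCoord_nonneg (E : starGroup H ≃+o starGroup H) (h g : H) (t : ℚ) :
    0 ≤ (E (armCoord h)).1 g t := by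
  have : 0 ≤ E (armCoord h) := by
    rw [← map_zero E]
    exact (map_le_map_iff E).2 (armCoord_nonneg h)
  exact this g t

end Star

/-! ### Slopes and similarities -/

/-- Two consecutive pieces of a piecewise linear function on an interval have slopes of the same
sign, provided the function is nonnegative, injective where positive, and has an open zero set away
from the left end. -/
theorem sign_slope_eq {φ : ℚ → ℚ} {a b d : ℚ} (hd : 0 < d) {x : ℚ} (hax : a ≤ x - d)
    (hxb : x + d ≤ b) {k l : ℤ} (hk : ∀ s, 0 ≤ s → s ≤ d → φ (x - s) = φ x - k * s)
    (hl : ∀ s, 0 ≤ s → s ≤ d → φ (x + s) = φ x + l * s)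
    (hnonneg : ∀ t, a ≤ t → t ≤ b → 0 ≤ φ t)
    (hinj : ∀ s t, a ≤ s → s ≤ b → a ≤ t → t ≤ b → 0 < φ s → φ s = φ t → s = t)
    (hopen : φ x = 0 → ∃ δ, 0 < δ ∧ ∀ s, a ≤ s → s ≤ b → |s - x| < δ → φ s = 0) :
    l.sign = k.sign := by
  rcases (hnonneg x (by linarith) (by linarith)).eq_or_lt with h0 | hpos
  · obtain ⟨δ, hδ, hz⟩ := hopen h0.symm
    set s := min d (δ / 2) with hs
    have hs0 : 0 < s := lt_min hd (by linarith)
    have hsd : s ≤ d := min_le_left _ _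
    have hsδ : s < δ := (min_le_right _ _).trans_lt (by linarith)
    have h1 := hk s hs0.le hsd
    have h2 := hl s hs0.le hsd
    have hm : |x - s - x| < δ := by rwa [sub_sub_cancel_left, abs_neg, abs_of_pos hs0]
    have hp : |x + s - x| < δ := by rwa [add_sub_cancel_left, abs_of_pos hs0]
    rw [hz _ (by linarith) (by linarith) hm, ← h0, zero_sub, eq_comm, neg_eq_zero,
      mul_eq_zero, or_iff_left hs0.ne'] at h1
    rw [hz _ (by linarith) (by linarith) hp, ← h0, zero_add, eq_comm, mul_eq_zero,
      or_iff_left hs0.ne'] at h2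
    rw [Int.cast_eq_zero.1 h1, Int.cast_eq_zero.1 h2]
  · have hk0 : k ≠ 0 := by
      rintro rfl
      have h1 := hk d hd.le le_rfl
      have := hinj x (x - d) (by linarith) (by linarith) hax (by linarith) hpos (by simp [h1])
      linarith
    have hl0 : l ≠ 0 := by
      rintro rfl
      have h1 := hl d hd.le le_rfl
      have := hinj x (x + d) (by linarith) (by linarith) (by linarith) hxb hpos (by simp [h1])
      linarith
    by_contra hne
    have hopp : (k : ℚ) * |(l : ℚ)| = -(l * |(k : ℚ)|) := by
      rcases lt_or_gt_of_ne hk0 with hk1 | hk1 <;> rcases lt_or_gt_of_ne hl0 with hl1 | hl1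
      · exact absurd (by rw [Int.sign_eq_neg_one_of_neg hk1, Int.sign_eq_neg_one_of_neg hl1]) hne
      · have hk2 : (k : ℚ) < 0 := by exact_mod_cast hk1
        have hl2 : (0 : ℚ) < l := by exact_mod_cast hl1
        rw [abs_of_neg hk2, abs_of_pos hl2]; ring
      · have hk2 : (0 : ℚ) < k := by exact_mod_cast hk1
        have hl2 : (l : ℚ) < 0 := by exact_mod_cast hl1
        rw [abs_of_pos hk2, abs_of_neg hl2]; ring
      · exact absurd (by rw [Int.sign_eq_one_of_pos hk1, Int.sign_eq_one_of_pos hl1]) hne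
    -- With slopes of opposite sign, the same value is taken on both sides of `x`.
    have hka : 0 < |(k : ℚ)| := abs_pos.2 (by exact_mod_cast hk0)
    have hla : 0 < |(l : ℚ)| := abs_pos.2 (by exact_mod_cast hl0)
    set τ := d / (|(k : ℚ)| + |(l : ℚ)|) with hτ
    have hτ0 : 0 < τ := by positivity
    have hsum : τ * |(k : ℚ)| + τ * |(l : ℚ)| = d := by
      rw [← mul_add]; exact div_mul_cancel₀ _ (by positivity)
    have hs1 : 0 < τ * |(l : ℚ)| := by positivity
    have hs2 : 0 < τ * |(k : ℚ)| := by positivity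
    have h1 := hk (τ * |(l : ℚ)|) hs1.le (by linarith)
    have h2 := hl (τ * |(k : ℚ)|) hs2.le (by linarith)
    have h3 := hk d hd.le le_rfl
    have h4 := hnonneg (x - d) hax (by linarith)
    have heq : φ (x - τ * |(l : ℚ)|) = φ (x + τ * |(k : ℚ)|) := by
      rw [h1, h2]; linear_combination -τ * hopp
    have hpos' : 0 < φ (x - τ * |(l : ℚ)|) := by
      rw [h1]
      rw [h3] at h4
      rcases le_or_gt (k : ℚ) 0 with hk1 | hk1
      · nlinarith
      · nlinarith
    have := hinj _ _ (by linarith) (by linarith) (by linarith) (by linarith) hpos' heq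
    linarith

section Star

variable {H : Subgroup {q : ℚ // 0 < q}}

/-- If `E (armCoord h)` is positive at the tip of the arm `g`, then all its slopes on this arm are
positive integers, and so it expands distances. -/
theorem map_armCoord_expanding [Infinite H] (E : starGroup H ≃+o starGroup H) {r : ℚ} (hr : 0 < r)
    (hE : ∀ a, E (constHom H a) = constHom H (r * a)) (h g : H)
    (hpos : 0 < (E (armCoord h)).1 g (len g)) {x : ℚ} (hx : 0 ≤ x) (hxg : x ≤ len g) :
    x ≤ (E (armCoord h)).1 g x ∧
      len g - x ≤ (E (armCoord h)).1 g (len g) - (E (armCoord h)).1 g x := by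
  obtain ⟨N₀, hN₀, hmesh⟩ := exists_mesh (E (armCoord h)).2
  have hinj := fun s t hs hsg ht htg =>
    map_armCoord_injOn E hr hE h g (s := s) (t := t) hs hsg ht htg
  have hnonneg : ∀ t, 0 ≤ (E (armCoord h)).1 g t := map_armCoord_nonneg E h g
  have hzero := map_armCoord_zero E hr hE h g
  have hopen := fun t ht htg => map_armCoord_zero_nhds E hr hE h g (t := t) ht htg
  replace hmesh := fun M h1 h2 => hmesh M h1 h2 g
  generalize (E (armCoord h)).1 g = φ at *
  -- A mesh that contains both the tip of the arm and the given point.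
  obtain ⟨M, hM, hdvd, n, hn, i, hi⟩ : ∃ M : ℕ, 0 < M ∧ N₀ ∣ M ∧
      ∃ n : ℕ, len g = n * (1 / M : ℚ) ∧ ∃ i : ℕ, x = i * (1 / M : ℚ) := by
    have hnum : ∀ y : ℚ, 0 ≤ y → ((y.num.toNat : ℕ) : ℚ) = y * y.den := fun y hy => by
      have : ((y.num.toNat : ℤ) : ℚ) = y.num := by
        rw [Int.toNat_of_nonneg (Rat.num_nonneg.2 hy)]
      rw [Rat.mul_den_eq_num, ← this, Int.cast_natCast]
    have hN₀' : (N₀ : ℚ) ≠ 0 := by positivity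
    have h1 : ((len g).den : ℚ) ≠ 0 := by exact_mod_cast (len g).den_nz
    have h2 : (x.den : ℚ) ≠ 0 := by exact_mod_cast x.den_nz
    refine ⟨N₀ * (len g).den * x.den, by positivity, Dvd.intro _ (mul_assoc _ _ _).symm,
      N₀ * (len g).num.toNat * x.den, ?_, N₀ * (len g).den * x.num.toNat, ?_⟩
    · push_cast [hnum _ (len_pos g).le]
      field_simp
    · push_cast [hnum _ hx]
      field_simp
  have hM' : (0 : ℚ) < M := by exact_mod_cast hM
  choose A K hK using fun j : ℕ => hmesh M hM hdvd j
  set d : ℚ := 1 / M with hd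
  have hd0 : 0 < d := by positivity
  have hMd : ∀ y, (M : ℚ) * (y * d) = y := fun y => by rw [hd]; field_simp
  have hpiece : ∀ j : ℕ, ∀ s, 0 ≤ s → s ≤ d → φ (j * d + s) = A j + K j * (j * d + s) := by
    intro j s h1 h2
    have h3 : (M : ℚ) * s ≤ 1 := by
      calc (M : ℚ) * s ≤ M * d := by gcongr
        _ = 1 := by rw [← one_mul d, hMd]
    have h4 : (0 : ℚ) ≤ M * s := by positivity
    refine hK j _ ?_ ?_ <;> rw [mul_add, hMd] <;> push_cast <;> linarith
  have hstep : ∀ j : ℕ, φ ((j + 1 : ℕ) * d) - φ (j * d) = K j * d := by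
    intro j
    have h1 := hpiece j 0 le_rfl hd0.le
    have h2 := hpiece j d hd0.le le_rfl
    rw [add_zero] at h1
    have h3 : ((j + 1 : ℕ) : ℚ) * d = j * d + d := by push_cast; ring
    rw [h3, h1, h2]; ring
  have hsign : ∀ j : ℕ, j < n → (K j).sign = (K 0).sign := by
    intro j
    induction j with
    | zero => exact fun _ => rfl
    | succ j ih =>
      intro hj
      rw [← ih (by omega)]
      have h3 : ((j + 1 : ℕ) : ℚ) * d = j * d + d := by push_cast; ring
      have h4 : ((j + 1 : ℕ) : ℚ) * d + d ≤ len g := by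
        have : ((j + 1 : ℕ) : ℚ) + 1 ≤ n := by exact_mod_cast hj
        rw [hn]
        nlinarith
      have h5 : (0 : ℚ) ≤ j * d := by positivity
      refine sign_slope_eq (φ := φ) (a := 0) (b := len g) (x := (j + 1 : ℕ) * d) hd0
        (by linarith) h4 (fun s h1 h2 => ?_) (fun s h1 h2 => ?_) (fun t _ _ => hnonneg t) hinj
        (hopen _ (by linarith) (by linarith))
      · have e1 := hpiece j (d - s) (by linarith) (by linarith)
        have e2 := hpiece j d hd0.le le_rfl
        rw [h3, e2, show (j : ℚ) * d + d - s = j * d + (d - s) by ring, e1]; ring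
      · have e1 := hpiece (j + 1) s h1 h2
        have e2 := hpiece (j + 1) 0 le_rfl hd0.le
        rw [add_zero] at e2
        rw [e1, e2]; ring
  have hK0 : 0 < K 0 := by
    by_contra hle
    have hneg : ∀ j : ℕ, j ≤ n → φ (j * d) ≤ 0 := by
      intro j
      induction j with
      | zero => intro _; simp [hzero]
      | succ j ih =>
        intro hj
        have h1 := hstep j
        have h2 : (K j : ℚ) ≤ 0 := by
          have : K j ≤ 0 := by
            rw [← Int.sign_nonpos_iff, hsign j (by omega), Int.sign_nonpos_iff]
            exact not_lt.1 hle
          exact_mod_cast this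
        have h3 := ih (by omega)
        nlinarith
    have := hneg n le_rfl
    rw [← hn] at this
    linarith
  have hKpos : ∀ j : ℕ, j < n → (1 : ℚ) ≤ K j := by
    intro j hj
    have : 0 < K j := by
      rw [← Int.sign_eq_one_iff_pos, hsign j hj, Int.sign_eq_one_of_pos hK0]
    exact_mod_cast this
  have hexp : ∀ p q : ℕ, p + q ≤ n → q * d ≤ φ ((p + q : ℕ) * d) - φ (p * d) := by
    intro p q
    induction q with
    | zero => intro _; simp
    | succ q ih =>
      intro hq
      have h1 := hstep (p + q)
      have h2 := hKpos (p + q) (by omega)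
      have h3 := ih (by omega)
      rw [← add_assoc]
      push_cast at h1 h3 ⊢
      nlinarith
  have hin : i ≤ n := by
    rw [hi, hn] at hxg
    exact_mod_cast le_of_mul_le_mul_right hxg hd0
  constructor
  · have := hexp 0 i (by omega)
    rw [zero_add, ← hi] at this
    simpa [hzero] using this
  · have := hexp i (n - i) (by omega)
    rw [Nat.add_sub_cancel' hin, ← hi, ← hn, Nat.cast_sub hin, sub_mul, ← hi, ← hn] at this
    exact this

/-- The tip of each arm is mapped to a point off the centre, at a distance from it that is bounded
below. -/
theorem exists_arm [Infinite H] (E : starGroup H ≃+o starGroup H) {r : ℚ} (hr : 0 < r)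
    (hE : ∀ a, E (constHom H a) = constHom H (r * a)) (g : H) :
    ∃ (h : H) (y : ℚ), 0 < y ∧ y ≤ len h ∧ (∀ f, (E f).1 g (len g) = r * f.1 h y) ∧
      len g ≤ r * y := by
  obtain ⟨h, y, h0, hl, hf⟩ := exists_point E hr hE g (len_pos g).le le_rfl
  obtain ⟨k, x, h0', hl', hf'⟩ := exists_point E hr hE g le_rfl (len_pos g).le
  have hx : x = 0 := by
    have := hf' (armCoord k)
    rwa [map_armCoord_zero E hr hE, armCoord_self h0' hl', eq_comm, mul_eq_zero,
      or_iff_right hr.ne'] at this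
  subst hx
  have hy : y ≠ 0 := by
    rintro rfl
    exact (len_pos g).ne (map_separates E g le_rfl (len_pos g).le (len_pos g).le le_rfl fun f => by
      rw [hf, hf', apply_zero_eq f.2 k h])
  have hy' : 0 < y := lt_of_le_of_ne h0 hy.symm
  have hval : (E (armCoord h)).1 g (len g) = r * y := by rw [hf, armCoord_self h0 hl]
  have := (map_armCoord_expanding E hr hE h g (by rw [hval]; positivity) (len_pos g).le le_rfl).1
  exact ⟨h, y, hy', hl, hf, by rwa [hval] at this⟩

/-- An automorphism maps arms to arms by similarities of ratio given by its action on constants.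
Neither the automorphism nor its inverse can shorten arms too much, so the lengths match, and
then there is no room for expansion. -/
theorem exists_arm_similarity [Infinite H] (E : starGroup H ≃+o starGroup H) {r : ℚ} (hr : 0 < r)
    (hE : ∀ a, E (constHom H a) = constHom H (r * a)) (g : H) :
    ∃ h : H, len g = r * len h ∧
      ∀ x, 0 ≤ x → x ≤ len g → ∀ f, (E f).1 g x = r * f.1 h (r⁻¹ * x) := by
  obtain ⟨h, y, hy, hyl, hf, hle⟩ := exists_arm E hr hE g
  have hr' : 0 < r⁻¹ := inv_pos.2 hr
  have hE' : ∀ a, E.symm (constHom H a) = constHom H (r⁻¹ * a) := fun a => by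
    apply EquivLike.injective E
    rw [OrderAddMonoidIso.apply_symm_apply, hE, mul_inv_cancel_left₀ hr.ne']
  obtain ⟨g', z, hz, hzl, hf', hle'⟩ := exists_arm E.symm hr' hE' h
  have hval : (E (armCoord h)).1 g (len g) = r * y := by rw [hf, armCoord_self hy.le hyl]
  have hg' : g' = g := by
    by_contra hne
    have h1 : (E.symm (armCoord g')).1 h (len h) = r⁻¹ * z := by
      rw [hf', armCoord_self hz.le hzl]
    have h2 := (map_armCoord_expanding E.symm hr' hE' g' h (by rw [h1]; positivity) hy.le hyl).1
    have h3 := hf (E.symm (armCoord g'))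
    rw [OrderAddMonoidIso.apply_symm_apply, armCoord_of_ne (Ne.symm hne), eq_comm, mul_eq_zero,
      or_iff_right hr.ne'] at h3
    linarith
  subst hg'
  have hlen : len g' = r * len h := by
    refine le_antisymm (hle.trans (by gcongr)) ?_
    have h1 : len h ≤ r⁻¹ * len g' := hle'.trans (by gcongr)
    rwa [← div_eq_inv_mul, le_div_iff₀' hr] at h1
  have hid : ∀ x, 0 ≤ x → x ≤ len g' → (E (armCoord h)).1 g' x = x := by
    intro x hx hxg
    obtain ⟨h1, h2⟩ := map_armCoord_expanding E hr hE h g' (by rw [hval]; positivity) hx hxg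
    have h3 : r * y ≤ r * len h := by gcongr
    rw [hval] at h2
    linarith
  refine ⟨h, hlen, fun x hx hxg f => ?_⟩
  obtain ⟨k, w, hw, hwl, hfw⟩ := exists_point E hr hE g' hx hxg
  rw [hfw]
  rcases hx.eq_or_lt with rfl | hx'
  · have h1 := hfw (armCoord k)
    rw [map_armCoord_zero E hr hE, armCoord_self hw hwl, eq_comm, mul_eq_zero,
      or_iff_right hr.ne'] at h1
    rw [h1, mul_zero, apply_zero_eq f.2 k h]
  · have h1 := hfw (armCoord h)
    rw [hid x hx hxg] at h1
    have hk : k = h := by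
      by_contra hne
      rw [armCoord_of_ne hne, mul_zero] at h1
      exact hx'.ne' h1
    subst hk
    rw [armCoord_self hw hwl] at h1
    rw [h1, inv_mul_cancel_left₀ hr.ne']

/-- The star is rigid: every automorphism of the ordered group of functions is induced by a
similarity of the star whose ratio belongs to `H`. -/
theorem exists_eq_scaleFun [Infinite H] (E : starGroup H ≃+o starGroup H) :
    ∃ r : H, ∀ f, (E f).1 = scaleFun r f.1 := by
  obtain ⟨r, hr, hE⟩ := exists_map_constHom E
  obtain ⟨k, hk, -⟩ := exists_arm_similarity E hr hE 1
  have hrk : len k⁻¹ = r := by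
    rw [len_inv]
    exact inv_eq_of_mul_eq_one_left (by rw [← hk, len_one])
  refine ⟨k⁻¹, fun f => funext fun g => funext fun x => ?_⟩
  obtain ⟨h, hlen, hf⟩ := exists_arm_similarity E hr hE g
  have hh : k⁻¹⁻¹ * g = h := by
    apply len_injective
    rw [len_mul, len_inv, hrk, hlen, inv_mul_cancel_left₀ hr.ne']
  have hr' : 0 ≤ r⁻¹ := (inv_pos.2 hr).le
  have hclamp : r⁻¹ * max 0 (min x (len g)) = max 0 (min (r⁻¹ * x) (len h)) := by
    rw [mul_max_of_nonneg _ _ hr', mul_min_of_nonneg _ _ hr', mul_zero, hlen,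
      inv_mul_cancel_left₀ hr.ne']
  rw [scaleFun, hh, hrk, ← apply_clamp (E f).2,
    hf _ (le_max_left _ _) (max_le (len_pos g).le (min_le_right _ _)), hclamp, apply_clamp f.2]

theorem scaleHom_bijective [Infinite H] : Function.Bijective (scaleHom (H := H)) := by
  constructor
  · intro r r' h
    have h1 : scaleFun r (starConst H 1) = scaleFun r' (starConst H 1) :=
      congrArg (fun e : orderAut (starGroup H) => ((e : starGroup H ≃o starGroup H)
        (constHom H 1)).1) h
    rw [scaleFun_starConst, scaleFun_starConst, mul_one, mul_one] at h1
    exact len_injective (congrFun (congrFun h1 1) 0)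
  · rintro ⟨e, he⟩
    let E : starGroup H ≃+o starGroup H :=
      { e.toEquiv with
        map_add' := he
        map_le_map_iff' := fun {_ _} => e.map_rel_iff }
    obtain ⟨r, hr⟩ := exists_eq_scaleFun E
    exact ⟨r, Subtype.ext (RelIso.ext fun f => Subtype.ext (hr f).symm)⟩

theorem isDimensionGroup_starGroup : IsDimensionGroup (starGroup H) (constHom H 1) where
  countable := countable_starGroup
  isOrderUnit := isOrderUnit_constHom_one
  exists_subgroup := exists_simplicial_subgroup_starGroup

end Star

/-! ### The trivial subgroup -/

theorem isDimensionGroup_int : IsDimensionGroup ℤ 1 where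
  countable := inferInstance
  isOrderUnit := by
    refine ⟨one_pos, fun x => ⟨x.toNat + 1, by omega, ?_⟩⟩
    rw [nsmul_one]; push_cast; omega
  exists_subgroup s := by
    classical
    obtain ⟨S, hS, hn⟩ := exists_simplicial_subgroup (D := ℤ) (ι := Unit) (fun _ => 1)
      (fun _ => zero_le_one) (fun _ => Int.castAddHom ℚ) (fun _ x hx => Int.cast_nonneg hx) 1
      one_pos (fun _ _ => by simp)
    refine ⟨S, fun x _ => ?_, hn⟩
    simpa using zsmul_mem (hS ()) x

theorem subsingleton_orderAut_int : Subsingleton (orderAut ℤ) := by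
  have key : ∀ e : orderAut ℤ, ∀ x : ℤ, (e : ℤ ≃o ℤ) x = x := by
    rintro ⟨e, he⟩ x
    let E : ℤ →+ ℤ := AddMonoidHom.mk' e he
    have hlin : ∀ x, e x = x * e 1 := fun x => by
      have : E (x • 1) = x • E 1 := map_zsmul E x 1
      rwa [smul_eq_mul, smul_eq_mul, mul_one] at this
    have h0 : e 0 = 0 := map_zero E
    have hpos : 0 < e 1 := by rw [← h0]; exact e.lt_iff_lt.2 one_pos
    obtain ⟨y, hy⟩ := e.surjective 1
    rw [hlin] at hy
    have : e 1 = 1 := Int.eq_one_of_dvd_one hpos.le (Dvd.intro_left y hy)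
    change e x = x
    rw [hlin, this, mul_one]
  exact ⟨fun e e' => Subtype.ext (RelIso.ext fun x => by rw [key, key])⟩

/-! ### Existence of the dimension group -/

theorem infinite_of_nontrivial (H : Subgroup {q : ℚ // 0 < q}) [Nontrivial H] : Infinite H := by
  obtain ⟨h, hh⟩ := exists_ne (1 : H)
  have hne : len h ≠ 1 := fun e => hh (len_injective e)
  have hpow : ∀ n : ℕ, len (h ^ n) = len h ^ n := fun n => by
    induction n with
    | zero => rfl
    | succ n ih => rw [pow_succ, len_mul, ih, pow_succ]
  refine Infinite.of_injective (fun n : ℕ => h ^ n) fun m n hmn => ?_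
  have := congrArg len hmn
  simp only [hpow] at this
  exact pow_right_injective₀ (len_pos h) hne this

theorem theorem2 (H : Subgroup {q : ℚ // 0 < q}) :
    ∃ (D : Type) (_ : AddCommGroup D) (_ : PartialOrder D) (_ : IsOrderedAddMonoid D) (u : D),
      IsDimensionGroup D u ∧
        ∃ e : H ≃* orderAut D,
          ∀ h : H, IsRatMul ((h : {q : ℚ // 0 < q}) : ℚ) u ((e h : D ≃o D) u) := by
  rcases subsingleton_or_nontrivial H with hH | hH
  · have := subsingleton_orderAut_int
    refine ⟨ℤ, inferInstance, inferInstance, inferInstance, 1, isDimensionGroup_int,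
      MulEquiv.ofBijective (1 : H →* orderAut ℤ) ⟨Function.injective_of_subsingleton _,
        fun e => ⟨1, Subsingleton.elim _ _⟩⟩, fun h => ?_⟩
    rw [Subsingleton.elim h 1]
    rfl
  · have := infinite_of_nontrivial H
    refine ⟨starGroup H, inferInstance, inferInstance, inferInstance, constHom H 1,
      isDimensionGroup_starGroup, MulEquiv.ofBijective scaleHom scaleHom_bijective, fun h => ?_⟩
    have h1 : (MulEquiv.ofBijective scaleHom scaleHom_bijective h : starGroup H ≃o starGroup H)
        (constHom H 1) = constHom H (len h) :=
      Subtype.ext (by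
        change scaleFun h (starConst H 1) = starConst H (len h)
        rw [scaleFun_starConst, mul_one])
    rw [h1, IsRatMul, ← map_nsmul, ← map_zsmul, nsmul_eq_mul, zsmul_eq_mul, mul_one]
    congr 1
    exact (mul_comm _ _).trans (Rat.mul_den_eq_num (len h))
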